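/- Call a map $C^{r,1}$ ($r\ge 0$) if all its derivatives up to order $r$ exist and are locally Lipschitz continuous. Let $M$ be a connected Riemannian manifold without boundary, modelled on a separable real Hilbert space, of class $C^{1,1}$, with Riemannian metric $\langle\cdot,\cdot\rangle_m$ of class $C^{0,1}$ (and norm $\|\cdot\|_m$ on $T_mM$ inducing its topology), and assume that $M$ is complete for the distance given by the infimum of the lengths of $C^1$ paths. Let $f\colon M\to\mathbb R$ be a $C^{1,1}$ function, and let $\nabla f$ be its gradient vector field, defined by $Df(m)(v)=\langle\nabla f(m),v\rangle_m$ for all $v\in T_mM$. Let $g\colon\mathbb R\to\mathbb R$ be any smooth monotone (nondecreasing) function with $g(x)=1$ for $x\le 1$, $g(x)\le x$ for $1\le x\le 2$, and $g(x)=x$ for $x\ge 2$; put $h(m)=1/g(\|\nabla f(m)\|_m)$ and $V=-h\,\nabla f$. Then the vector field $V$ integrates to a unique continuous flow $\{\varphi_t\}_{t\in\mathbb R}$ on $M$. Moreover, suppose that $f$ satisfies the Palais–Smale condition (C): if $A\subseteq M$ is a set on which $|f|$ is bounded but on which $\|\nabla f\|$ is not bounded away from zero, then there is a critical point of $f$ (a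 zero of $\nabla f$) in the closure of $A$. Then for every $\tau>0$ the pair $(f,\varphi_\tau)$ satisfies condition (D): $f$ and $\varphi_\tau$ are continuous; $f$ is a Lyapunov function for $\varphi_\tau$, that is, $f(\varphi_\tau(x))<f(x)$ whenever $\varphi_\tau(x)\ne x$; and if $A\subseteq M$ is a set on which $|f|$ is bounded but on which $f(y)-f(\varphi_\tau(y))$ is not bounded away from zero, then there is a fixed point of $\varphi_\tau$ in the closure of $A$. -/

import Mathlib

open Bundle
open scoped Manifold ContDiff Topology

noncomputable section

namespace LusternikSchnirelmann

section ConditionD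

variable {X : Type*} [TopologicalSpace X]

/-- `f` is a Lyapunov function for `φ`: it strictly decreases at points not fixed by `φ`. -/
def IsLyapunov (f : X → ℝ) (φ : X → X) : Prop :=
  ∀ x, φ x ≠ x → f (φ x) < f x

/-- Condition (D) on `Y` for the pair `(f, φ)` of a continuous function and a continuous self-map:
`f` is a Lyapunov function for `φ`, and if `|f|` is bounded on `A ⊆ Y` while `f - f ∘ φ` is not
bounded away from zero on `A`, then `φ` has a fixed point in the closure of `A`. -/
def ConditionDOn (f : X → ℝ) (φ : X → X) (Y : Set X) : Prop :=
  Continuous f ∧ Continuous φ ∧ IsLyapunov f φ ∧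
    ∀ A : Set X, A ⊆ Y → (∃ c : ℝ, ∀ y ∈ A, |f y| ≤ c) →
      (∀ ε : ℝ, 0 < ε → ∃ y ∈ A, |f y - f (φ y)| < ε) →
      ∃ x ∈ closure A, φ x = x

/-- Condition (D), on the whole space. -/
def ConditionD (f : X → ℝ) (φ : X → X) : Prop :=
  ConditionDOn f φ Set.univ

end ConditionD

section Regularity

/-- `f` is of class `C^{1,1}` on the open set `s` of a normed space: `f` is differentiable on `s`,
and `f` and its derivative are locally Lipschitz on `s`. -/
def C11On {E F : Type*} [NormedAddCommGroup E] [NormedSpace ℝ E]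
    [NormedAddCommGroup F] [NormedSpace ℝ F] (f : E → F) (s : Set E) : Prop :=
  DifferentiableOn ℝ f s ∧ LocallyLipschitzOn s f ∧ LocallyLipschitzOn s (fderiv ℝ f)

variable {E : Type*} [NormedAddCommGroup E] [InnerProductSpace ℝ E]

/-- The manifold `M`, modelled on `E`, is of class `C^{1,1}`: all changes of charts are. -/
def IsC11Manifold (E : Type*) [NormedAddCommGroup E] [InnerProductSpace ℝ E]
    (M : Type*) [TopologicalSpace M] [ChartedSpace E M] : Prop :=
  ∀ e ∈ atlas E M, ∀ e' ∈ atlas E M, C11On (e.symm ≫ₕ e') (e.symm ≫ₕ e').source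

variable {M : Type*} [TopologicalSpace M] [ChartedSpace E M]

/-- The real function `f` on `M` is of class `C^{1,1}`: it is so in all charts. -/
def IsC11Function (E : Type*) [NormedAddCommGroup E] [InnerProductSpace ℝ E]
    {M : Type*} [TopologicalSpace M] [ChartedSpace E M] (f : M → ℝ) : Prop :=
  ∀ e ∈ atlas E M, C11On (f ∘ e.symm) e.target

variable [RiemannianBundle (fun x : M ↦ TangentSpace 𝓘(ℝ, E) x)]

/-- The Riemannian metric of `M` read in the chart `e`, at the point `y` of the target of `e`. -/
def chartMetric (e : OpenPartialHomeomorph M E) (y u v : E) : ℝ :=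
  inner ℝ (mfderiv 𝓘(ℝ, E) 𝓘(ℝ, E) e.symm y u : TangentSpace 𝓘(ℝ, E) (e.symm y))
    (mfderiv 𝓘(ℝ, E) 𝓘(ℝ, E) e.symm y v : TangentSpace 𝓘(ℝ, E) (e.symm y))

/-- The Riemannian metric of `M` is of class `C^{0,1}`: in each chart it is a locally Lipschitz map
to the continuous bilinear forms on `E` (with the operator norm, written out here). -/
def IsC01Metric (E : Type*) [NormedAddCommGroup E] [InnerProductSpace ℝ E]
    (M : Type*) [TopologicalSpace M] [ChartedSpace E M]
    [RiemannianBundle (fun x : M ↦ TangentSpace 𝓘(ℝ, E) x)] : Prop :=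
  ∀ e ∈ atlas E M, ∀ y₀ ∈ e.target, ∃ K : ℝ, ∃ U ∈ 𝓝 y₀, U ⊆ e.target ∧
    ∀ y ∈ U, ∀ y' ∈ U, ∀ u v : E,
      |chartMetric e y u v - chartMetric e y' u v| ≤ K * ‖y - y'‖ * ‖u‖ * ‖v‖

end Regularity

section Gradient

variable {E : Type*} [NormedAddCommGroup E] [InnerProductSpace ℝ E] [CompleteSpace E]
  {M : Type*} [TopologicalSpace M] [ChartedSpace E M]
  [RiemannianBundle (fun x : M ↦ TangentSpace 𝓘(ℝ, E) x)]

/-- Tangent spaces are complete for the Riemannian norm, because it induces their topology. -/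
theorem completeSpace_tangentSpace (m : M) : CompleteSpace (TangentSpace 𝓘(ℝ, E) m) := by
  have h : (inferInstance : NormedAddCommGroup (TangentSpace 𝓘(ℝ, E) m)).toUniformSpace =
      (‹NormedAddCommGroup E› : NormedAddCommGroup E).toUniformSpace := by
    refine @IsUniformAddGroup.ext E _ _ _ ?_ ?_ rfl
    · exact inferInstanceAs (IsUniformAddGroup (TangentSpace 𝓘(ℝ, E) m))
    · infer_instance
  have h2 : CompleteSpace E := inferInstance
  rw [h]
  exact h2

/-- The gradient of `f` at `m`: the Riesz representative of the derivative of `f` at `m` with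
respect to the Riemannian inner product on the tangent space. -/
def gradient (f : M → ℝ) (m : M) : TangentSpace 𝓘(ℝ, E) m :=
  haveI : CompleteSpace (TangentSpace 𝓘(ℝ, E) m) := completeSpace_tangentSpace m
  (InnerProductSpace.toDual ℝ (TangentSpace 𝓘(ℝ, E) m)).symm (mfderiv 𝓘(ℝ, E) 𝓘(ℝ, ℝ) f m)

theorem inner_gradient (f : M → ℝ) (m : M) (v : TangentSpace 𝓘(ℝ, E) m) :
    inner ℝ (gradient f m) v = mfderiv 𝓘(ℝ, E) 𝓘(ℝ, ℝ) f m v := by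
  have : CompleteSpace (TangentSpace 𝓘(ℝ, E) m) := completeSpace_tangentSpace m
  exact InnerProductSpace.toDual_symm_apply

/-- The Palais–Smale condition (C). -/
def PalaisSmale (E : Type*) [NormedAddCommGroup E] [InnerProductSpace ℝ E] [CompleteSpace E]
    {M : Type*} [TopologicalSpace M] [ChartedSpace E M]
    [RiemannianBundle (fun x : M ↦ TangentSpace 𝓘(ℝ, E) x)] (f : M → ℝ) : Prop :=
  ∀ A : Set M, (∃ c : ℝ, ∀ m ∈ A, |f m| ≤ c) →
    (∀ ε : ℝ, 0 < ε → ∃ m ∈ A, ‖(gradient f m : TangentSpace 𝓘(ℝ, E) m)‖ < ε) →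
    ∃ m ∈ closure A, (gradient f m : TangentSpace 𝓘(ℝ, E) m) = 0

/-- The cut-off functions used to normalize the gradient. -/
structure IsNormalizer (g : ℝ → ℝ) : Prop where
  smooth : ContDiff ℝ ∞ g
  mono : Monotone g
  eq_one : ∀ x, x ≤ 1 → g x = 1
  le_self : ∀ x, 1 ≤ x → x ≤ 2 → g x ≤ x
  eq_self : ∀ x, 2 ≤ x → g x = x

/-- The normalized negative gradient field `- h ∇f`, where `h m = 1 / g ‖∇f m‖`. -/
def normalizedField (g : ℝ → ℝ) (f : M → ℝ) (m : M) : TangentSpace 𝓘(ℝ, E) m :=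
  -((1 / g ‖(gradient f m : TangentSpace 𝓘(ℝ, E) m)‖) • gradient f m)

/-- The (continuous, complete) flow `φ` is a flow of the vector field `V`: its orbits are integral
curves of `V`. -/
def IsFlowOf (φ : Flow ℝ M) (V : (m : M) → TangentSpace 𝓘(ℝ, E) m) : Prop :=
  ∀ m : M, IsMIntegralCurve (I := 𝓘(ℝ, E)) (fun t : ℝ ↦ φ t m) V

end Gradient

end LusternikSchnirelmann

end

open LusternikSchnirelmann

/-! In a chart, ⟨∇f, ·⟩ = Df says that ∇f represents a locally Lipschitz family of linear forms with
respect to a locally Lipschitz, locally uniformly coercive family of bilinear forms. Hence ∇f is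
locally Lipschitz (`lipschitzOnWith_of_bilinear_representative`), and so is V, because h is a C¹
function of ‖∇f‖². Picard–Lindelöf gives local flows and uniqueness. As ‖V‖ ≤ 2, integral curves are
Lipschitz, so by completeness they converge at finite end times and extend: the flow is global
(`LocallyLipschitzField.existsUnique_flow_of_bounded`).

Along the flow, f decreases at the rate ρ = ‖∇f‖² / g(‖∇f‖). This gives the Lyapunov property, since
zeros of ∇f are stationary. If f drops by less and less in time τ from points yₙ of A, the mean
value theorem gives points zₙ on the orbit segments with ρ(zₙ) → 0. Then ∇f(zₙ) → 0, and (C) yields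
a critical point p in the closure of the zₙ. It also lies in the closure of A: since ‖V‖² ≤ ρ, a
small drop of f forces a short orbit segment (`IsFlowOf.exists_edist_lt`), so yₙ is close to zₙ. -/

/-! ### Integral curves in charts: uniqueness and local flows -/

section IntegralCurves

open Set Filter

variable {E : Type*} [NormedAddCommGroup E] [InnerProductSpace ℝ E]
  {M : Type*} [TopologicalSpace M] [ChartedSpace E M]

/-- The vector field `v` read in the chart `e`. -/
noncomputable def chartField (e : OpenPartialHomeomorph M E) (v : (m : M) → TangentSpace 𝓘(ℝ, E) m) (y : E) : E :=
  mfderiv 𝓘(ℝ, E) 𝓘(ℝ, E) e (e.symm y) (v (e.symm y))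

/-- The vector field `v` is locally Lipschitz in the preferred charts. -/
def LocallyLipschitzField (v : (m : M) → TangentSpace 𝓘(ℝ, E) m) : Prop :=
  ∀ p : M, ∃ K, ∃ U ∈ 𝓝 (chartAt E p p), LipschitzOnWith K (chartField (chartAt E p) v) U

variable [IsManifold 𝓘(ℝ, E) 1 M] {v : (m : M) → TangentSpace 𝓘(ℝ, E) m}
  {e : OpenPartialHomeomorph M E} {γ γ' : ℝ → M} {t t₀ : ℝ}

theorem HasMFDerivAt.hasDerivAt_chart_comp (he : e ∈ atlas E M)
    (hγ : HasMFDerivAt 𝓘(ℝ, ℝ) 𝓘(ℝ, E) γ t ((1 : ℝ →L[ℝ] ℝ).smulRight (v (γ t))))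
    (ht : γ t ∈ e.source) :
    HasDerivAt (e ∘ γ) (chartField e v (e (γ t))) t := by
  have h1 := ((mdifferentiable_of_mem_atlas (I := 𝓘(ℝ, E)) he).mdifferentiableAt ht).hasMFDerivAt
  refine hasDerivAt_iff_hasFDerivAt.2 (hasMFDerivAt_iff_hasFDerivAt.1 ?_)
  refine (h1.comp t hγ).congr_mfderiv (ContinuousLinearMap.ext fun a ↦ ?_)
  rw [chartField, e.left_inv ht]
  exact (mfderiv 𝓘(ℝ, E) 𝓘(ℝ, E) e (γ t)).map_smul a (v (γ t))

theorem HasDerivAt.hasMFDerivAt_chart_symm_comp (he : e ∈ atlas E M) {σ : ℝ → E}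
    (hσ : HasDerivAt σ (chartField e v (σ t)) t) (ht : σ t ∈ e.target) :
    HasMFDerivAt 𝓘(ℝ, ℝ) 𝓘(ℝ, E) (e.symm ∘ σ) t
      ((1 : ℝ →L[ℝ] ℝ).smulRight (v (e.symm (σ t)))) := by
  have hd := mdifferentiable_of_mem_atlas (I := 𝓘(ℝ, E)) he
  have h1 := (hd.mdifferentiableAt_symm ht).hasMFDerivAt
  have h3 := hd.symm_comp_deriv (e.map_target ht)
  rw [e.right_inv ht] at h3
  refine (h1.comp t (hasMFDerivAt_iff_hasFDerivAt.2 hσ.hasFDerivAt)).congr_mfderiv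
    (ContinuousLinearMap.ext fun a ↦ ?_)
  have h4 := DFunLike.congr_fun h3 (v (e.symm (σ t)))
  have h5 := (mfderiv 𝓘(ℝ, E) 𝓘(ℝ, E) e.symm (σ t)).map_smul (show ℝ from a)
    (mfderiv 𝓘(ℝ, E) 𝓘(ℝ, E) e (e.symm (σ t)) (v (e.symm (σ t))))
  exact h5.trans (congrArg (fun w : TangentSpace 𝓘(ℝ, E) (e.symm (σ t)) ↦ (show ℝ from a) • w) h4)

/-- Both curves stay near the common point for a short time, where the chart turns the claim into
uniqueness for a Lipschitz ODE. -/
theorem IsMIntegralCurveAt.eventuallyEq_of_locallyLipschitzField (hv : LocallyLipschitzField v)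
    (hγ : IsMIntegralCurveAt γ v t₀) (hγ' : IsMIntegralCurveAt γ' v t₀) (h : γ t₀ = γ' t₀) :
    γ =ᶠ[𝓝 t₀] γ' := by
  obtain ⟨K, U, hU, hlip⟩ := hv (γ t₀)
  set e := chartAt E (γ t₀) with he
  have key : ∀ {η : ℝ → M}, IsMIntegralCurveAt η v t₀ → η t₀ = γ t₀ →
      ∀ᶠ t in 𝓝 t₀, η t ∈ e.source ∧
        (HasDerivAt (e ∘ η) (chartField e v ((e ∘ η) t)) t ∧ (e ∘ η) t ∈ U) := by
    intro η hη h0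
    have hs : η t₀ ∈ e.source := by rw [h0]; exact mem_chart_source E (γ t₀)
    have h1 := hη.continuousAt.eventually (e.open_source.mem_nhds hs)
    have h2 : ContinuousAt (e ∘ η) t₀ := (e.continuousAt hs).comp hη.continuousAt
    have h3 := h2.eventually (p := fun y ↦ y ∈ U) (by simpa [h0] using hU)
    filter_upwards [h1, h3, hη] with t h1 h3 h4
    exact ⟨h1, h4.hasDerivAt_chart_comp (chart_mem_atlas E _) h1, h3⟩
  have k1 := key hγ rfl
  have k2 := key hγ' h.symm
  have := ODE_solution_unique_of_eventually (v := fun _ ↦ chartField e v) (s := fun _ ↦ U)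
    (.of_forall fun _ ↦ hlip) (k1.mono fun _ h ↦ h.2) (k2.mono fun _ h ↦ h.2) (by simp [h])
  filter_upwards [k1, k2, this] with t h1 h2 h3
  exact e.injOn h1.1 h2.1 h3

theorem IsMIntegralCurveOn.eqOn_Ioo_of_locallyLipschitzField [T2Space M] {a b : ℝ}
    (hv : LocallyLipschitzField v) (ht₀ : t₀ ∈ Ioo a b)
    (hγ : IsMIntegralCurveOn γ v (Ioo a b)) (hγ' : IsMIntegralCurveOn γ' v (Ioo a b))
    (h : γ t₀ = γ' t₀) : EqOn γ γ' (Ioo a b) := by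
  set s := {t | γ t = γ' t} ∩ Ioo a b with hs
  suffices hsub : Ioo a b ⊆ s from fun t ht ↦ (hsub ht).1
  -- The agreement set is open by local uniqueness and relatively closed because `M` is Hausdorff;
  -- the interval is connected.
  refine isPreconnected_Ioo.subset_of_closure_inter_subset (s := Ioo a b) (u := s) ?_
    ⟨t₀, ht₀, h, ht₀⟩ ?_
  · rw [isOpen_iff_mem_nhds]
    intro t₁ ht₁
    have hmem := Ioo_mem_nhds ht₁.2.1 ht₁.2.2
    have heq := (hγ.isMIntegralCurveAt hmem).eventuallyEq_of_locallyLipschitzField hv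
      (hγ'.isMIntegralCurveAt hmem) ht₁.1
    exact (heq.and hmem).mono fun _ ht ↦ ht
  · rintro t ⟨htc, ht⟩
    refine ⟨?_, ht⟩
    have : (𝓝[s] t).NeBot := mem_closure_iff_nhdsWithin_neBot.1 htc
    have h1 : Tendsto γ (𝓝[s] t) (𝓝 (γ t)) := ((hγ.continuousOn t ht).mono inter_subset_right)
    have h2 : Tendsto γ' (𝓝[s] t) (𝓝 (γ' t)) := ((hγ'.continuousOn t ht).mono inter_subset_right)
    refine tendsto_nhds_unique_of_eventuallyEq h1 h2 ?_
    filter_upwards [self_mem_nhdsWithin] with r hr using hr.1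

theorem IsMIntegralCurve.eq_of_locallyLipschitzField [T2Space M]
    (hv : LocallyLipschitzField v) (hγ : IsMIntegralCurve γ v) (hγ' : IsMIntegralCurve γ' v)
    (h : γ t₀ = γ' t₀) : γ = γ' := by
  funext t
  have h1 : ∀ s : ℝ, |s| ≤ |t| + |t₀| → s ∈ Ioo (-(|t| + |t₀| + 1)) (|t| + |t₀| + 1) := by
    intro s hs
    rw [mem_Ioo, ← abs_lt]
    linarith
  exact (hγ.isMIntegralCurveOn _).eqOn_Ioo_of_locallyLipschitzField hv
    (h1 t₀ (by linarith [abs_nonneg t])) (hγ'.isMIntegralCurveOn _) h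
    (h1 t (by linarith [abs_nonneg t₀]))

/-- A Lipschitz vector field near a point satisfies the Picard–Lindelöf hypotheses. -/
theorem LipschitzOnWith.exists_isPicardLindelof {F : Type*} [NormedAddCommGroup F]
    [NormedSpace ℝ F] {w : F → F} {x₀ : F} {K : NNReal} {U : Set F} (hU : U ∈ 𝓝 x₀)
    (hw : LipschitzOnWith K w U) :
    ∃ (ε : ℝ) (hε : 0 < ε) (a r L : NNReal) (_ : 0 < r), IsPicardLindelof (fun _ ↦ w)
      (tmin := -ε) (tmax := ε) ⟨0, by simp [hε.le]⟩ x₀ a r L K := by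
  obtain ⟨a, ha, haU⟩ := Metric.nhds_basis_closedBall.mem_iff.1 hU
  lift a to NNReal using ha.le
  have ha' : 0 < a := ha
  -- A speed bound on the ball of radius `a`; the summand 1 keeps it positive.
  set L : NNReal := K * a + ‖w x₀‖₊ + 1 with hL
  have hL0 : 0 < L := by positivity
  -- Starting within `a / 2` of the centre and moving at speed at most `L` for time `a / (2 * L)`, a
  -- solution stays in the ball of radius `a`.
  refine ⟨(a / L / 2 : NNReal), by positivity, a, a / 2, L, by positivity,
    .of_time_independent (fun x hx ↦ ?_) (hw.mono haU) ?_⟩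
  · have h1 := hw.norm_sub_le (haU hx) (mem_of_mem_nhds hU)
    have h2 : ‖x - x₀‖ ≤ a := mem_closedBall_iff_norm.1 hx
    have h3 : ‖w x‖ ≤ ‖w x - w x₀‖ + ‖w x₀‖ := norm_le_norm_sub_add _ _
    have h4 : (K : ℝ) * ‖x - x₀‖ ≤ K * a := by gcongr
    simp only [hL, NNReal.coe_add, NNReal.coe_mul, coe_nnnorm, NNReal.coe_one]
    linarith
  · have : (0 : ℝ) < L := hL0
    simp only [sub_zero, zero_sub, neg_neg, max_self, NNReal.coe_div, NNReal.coe_ofNat]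
    field_simp
    norm_num

/-- A locally Lipschitz vector field has a continuous local flow near every point. -/
theorem LocallyLipschitzField.exists_localFlow [CompleteSpace E] (hv : LocallyLipschitzField v)
    (p : M) : ∃ ε > 0, ∃ U ∈ 𝓝 p, ∃ α : M → ℝ → M,
      (∀ x ∈ U, α x 0 = x ∧ IsMIntegralCurveOn (α x) v (Ioo (-ε) ε)) ∧
      ContinuousOn (Function.uncurry α) (U ×ˢ Ioo (-ε) ε) := by
  obtain ⟨K, U, hU, hlip⟩ := hv p
  set e := chartAt E p with he
  have hp : p ∈ e.source := mem_chart_source E p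
  obtain ⟨ε, hε, a, r, L, hr, hpl⟩ := hlip.exists_isPicardLindelof hU
  obtain ⟨β, hβ, hβc⟩ := hpl.exists_forall_mem_closedBall_eq_hasDerivWithinAt_continuousOn
  have hr' : (0 : ℝ) < r := hr
  have hβ0 : β (e p, 0) = e p := (hβ _ (Metric.mem_closedBall_self hr'.le)).1
  have hcont : ContinuousAt β (e p, 0) := hβc.continuousAt
    (prod_mem_nhds (Metric.closedBall_mem_nhds _ hr') (Icc_mem_nhds (by linarith) hε))
  -- The solution in `E` has to be kept inside the chart target before it can be pulled back to `M`.
  have hmem : β ⁻¹' e.target ∩ (Metric.closedBall (e p) r ×ˢ Ioo (-ε) ε) ∈ 𝓝 (e p, (0 : ℝ)) :=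
    inter_mem (hcont.preimage_mem_nhds (by rw [hβ0]; exact e.open_target.mem_nhds (e.map_source hp)))
      (prod_mem_nhds (Metric.closedBall_mem_nhds _ hr') (Ioo_mem_nhds (by linarith) hε))
  obtain ⟨A, hA, B, hB, hAB⟩ := mem_nhds_prod_iff.1 hmem
  obtain ⟨δ, hδ, hδB⟩ := Metric.mem_nhds_iff.1 hB
  rw [Real.ball_eq_Ioo, zero_sub, zero_add] at hδB
  refine ⟨δ, hδ, e.source ∩ e ⁻¹' A, inter_mem (e.open_source.mem_nhds hp)
    ((e.continuousAt hp).preimage_mem_nhds hA), fun x t ↦ e.symm (β (e x, t)), ?_, ?_⟩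
  · rintro x ⟨hxs, hxA⟩
    have hx0 := hAB (mk_mem_prod hxA (hδB ⟨neg_lt_zero.2 hδ, hδ⟩))
    obtain ⟨h1, h2⟩ := hβ (e x) hx0.2.1
    refine ⟨by simp only [h1, e.left_inv hxs], fun t ht ↦ HasMFDerivAt.hasMFDerivWithinAt ?_⟩
    have hxt := hAB (mk_mem_prod hxA (hδB ht))
    have h3 := (h2 t (Ioo_subset_Icc_self hxt.2.2)).hasDerivAt (Icc_mem_nhds hxt.2.2.1 hxt.2.2.2)
    exact HasDerivAt.hasMFDerivAt_chart_symm_comp (σ := fun t ↦ β (e x, t))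
      (chart_mem_atlas E p) h3 hxt.1
  · rintro ⟨x, t⟩ ⟨⟨hxs, hxA⟩, ht⟩
    have hxt := hAB (mk_mem_prod hxA (hδB ht))
    have h1 : ContinuousWithinAt (fun z : M × ℝ ↦ (e z.1, z.2))
        ((e.source ∩ e ⁻¹' A) ×ˢ Ioo (-δ) δ) (x, t) :=
      (((e.continuousAt hxs).comp continuousAt_fst).prodMk continuousAt_snd).continuousWithinAt
    have h2 := ContinuousWithinAt.comp (f := fun z : M × ℝ ↦ (e z.1, z.2)) (x := (x, t))
      (hβc (e x, t) ⟨hxt.2.1, Ioo_subset_Icc_self hxt.2.2⟩) h1 (by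
      rintro ⟨x', t'⟩ ⟨⟨_, hx'⟩, ht'⟩
      have := hAB (mk_mem_prod hx' (hδB ht'))
      exact ⟨this.2.1, Ioo_subset_Icc_self this.2.2⟩)
    exact (e.symm.continuousAt (by simpa using hxt.1)).comp_continuousWithinAt h2

end IntegralCurves

/-! ### From local solutions to a global continuous flow -/

section GlobalFlow

open Set Filter

variable {E : Type*} [NormedAddCommGroup E] [InnerProductSpace ℝ E]

section Gluing

variable {M : Type*} [TopologicalSpace M] [T2Space M] [ChartedSpace E M] [IsManifold 𝓘(ℝ, E) 1 M]
  {v : (m : M) → TangentSpace 𝓘(ℝ, E) m} {γ γ' : ℝ → M} {t₀ : ℝ}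

/-- Two integral curves agreeing at a common time glue to an integral curve. -/
theorem IsMIntegralCurveOn.piecewise_of_locallyLipschitzField (hv : LocallyLipschitzField v)
    {a b a' b' : ℝ} (hγ : IsMIntegralCurveOn γ v (Ioo a b))
    (hγ' : IsMIntegralCurveOn γ' v (Ioo a' b')) (ht₀ : t₀ ∈ Ioo a b ∩ Ioo a' b')
    (h : γ t₀ = γ' t₀) [DecidablePred (· ∈ Ioo a b)] :
    IsMIntegralCurveOn ((Ioo a b).piecewise γ γ') v (Ioo a b ∪ Ioo a' b') := by
  have H : EqOn γ γ' (Ioo (max a a') (min b b')) :=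
    (hγ.mono (Ioo_subset_Ioo (le_max_left ..) (min_le_left ..))).eqOn_Ioo_of_locallyLipschitzField
      hv ⟨max_lt ht₀.1.1 ht₀.2.1, lt_min ht₀.1.2 ht₀.2.2⟩
      (hγ'.mono (Ioo_subset_Ioo (le_max_right ..) (min_le_right ..))) h
  have H' : EqOn ((Ioo a b).piecewise γ γ') γ' (Ioo a' b') := by
    intro t ht
    by_cases hmem : t ∈ Ioo a b
    · rw [piecewise_eq_of_mem _ _ _ hmem]
      exact H ⟨max_lt hmem.1 ht.1, lt_min hmem.2 ht.2⟩
    · rw [piecewise_eq_of_notMem _ _ _ hmem]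
  refine IsMIntegralCurveAt.isMIntegralCurveOn fun t ht ↦ ?_
  have key : ∀ {c d : ℝ} {η : ℝ → M}, IsMIntegralCurveOn η v (Ioo c d) → t ∈ Ioo c d →
      EqOn ((Ioo a b).piecewise γ γ') η (Ioo c d) →
      IsMIntegralCurveAt ((Ioo a b).piecewise γ γ') v t := by
    intro c d η hη htc heq
    have hn := isOpen_Ioo.mem_nhds htc
    filter_upwards [hη.isMIntegralCurveAt hn, hn] with s hs hsn
    have h1 : (Ioo a b).piecewise γ γ' =ᶠ[𝓝 s] η := by
      filter_upwards [isOpen_Ioo.mem_nhds hsn] with r hr using heq hr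
    rw [heq hsn]
    exact hs.congr_of_eventuallyEq h1
  rcases ht with ht | ht
  · exact key hγ ht (piecewise_eqOn _ _ _)
  · exact key hγ' ht H'

/-- Integral curves with the same value at `0` on symmetric intervals glue to an integral curve on
the union of these intervals. -/
theorem LocallyLipschitzField.exists_isMIntegralCurveOn_iUnion (hv : LocallyLipschitzField v)
    {S : Set ℝ} {x : M} (hS : ∀ a ∈ S, ∃ γ : ℝ → M, γ 0 = x ∧ IsMIntegralCurveOn γ v (Ioo (-a) a))
    {ε : ℝ} (hε : 0 < ε) (hεS : ε ∈ S) :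
    ∃ γ : ℝ → M, γ 0 = x ∧ IsMIntegralCurveOn γ v (⋃ a ∈ S, Ioo (-a) a) := by
  classical
  have : Nonempty (ℝ → M) := ⟨fun _ ↦ x⟩
  choose! Γ hΓ0 hΓ using hS
  have hex : ∀ t : ℝ, ∃ a, t ∈ (⋃ a ∈ S, Ioo (-a) a) → a ∈ S ∧ t ∈ Ioo (-a) a := by
    intro t
    by_cases ht : t ∈ (⋃ a ∈ S, Ioo (-a) a)
    · obtain ⟨a, ha, hta⟩ := mem_iUnion₂.1 ht
      exact ⟨a, fun _ ↦ ⟨ha, hta⟩⟩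
    · exact ⟨0, fun h ↦ absurd h ht⟩
  choose A hA using hex
  have hle : ∀ {a b : ℝ}, a ∈ S → b ∈ S → a ≤ b → EqOn (Γ a) (Γ b) (Ioo (-a) a) := by
    intro a b ha hb hab t ht
    have h0 : 0 < a := by linarith [ht.1, ht.2]
    exact (hΓ a ha).eqOn_Ioo_of_locallyLipschitzField hv (t₀ := 0) ⟨by linarith, h0⟩
      ((hΓ b hb).mono (Ioo_subset_Ioo (by linarith) hab)) (by rw [hΓ0 a ha, hΓ0 b hb]) ht
  have heq : ∀ a ∈ S, EqOn (fun t ↦ Γ (A t) t) (Γ a) (Ioo (-a) a) := by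
    intro a ha t ht
    obtain ⟨h1, h2⟩ := hA t (mem_iUnion₂.2 ⟨a, ha, ht⟩)
    rcases le_total a (A t) with h | h
    · exact (hle ha h1 h ht).symm
    · exact hle h1 ha h h2
  refine ⟨fun t ↦ Γ (A t) t, ?_, IsMIntegralCurveAt.isMIntegralCurveOn fun t ht ↦ ?_⟩
  · rw [heq ε hεS ⟨by linarith, hε⟩, hΓ0 ε hεS]
  · obtain ⟨a, ha, hta⟩ := mem_iUnion₂.1 ht
    have hn := isOpen_Ioo.mem_nhds hta
    filter_upwards [(hΓ a ha).isMIntegralCurveAt hn, hn] with s hs hsn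
    have h1 : (fun t ↦ Γ (A t) t) =ᶠ[𝓝 s] Γ a := by
      filter_upwards [isOpen_Ioo.mem_nhds hsn] with r hr using heq a ha hr
    rw [show Γ (A s) s = Γ a s from heq a ha hsn]
    exact hs.congr_of_eventuallyEq h1

/-- An integral curve on an open interval having a limit at a point of the closed interval extends
past this point. -/
theorem LocallyLipschitzField.exists_extension [CompleteSpace E] (hv : LocallyLipschitzField v)
    {a b c : ℝ} (hab : a < b) (hc : c ∈ Icc a b) (hγ : IsMIntegralCurveOn γ v (Ioo a b)) {p : M}
    (hp : Tendsto γ (𝓝[Ioo a b] c) (𝓝 p)) :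
    ∃ δ > 0, ∃ η : ℝ → M, EqOn η γ (Ioo a b) ∧
      IsMIntegralCurveOn η v (Ioo a b ∪ Ioo (c - δ) (c + δ)) := by
  classical
  obtain ⟨ε, hε, U, hU, α, hα, -⟩ := hv.exists_localFlow p
  have : (𝓝[Ioo a b] c).NeBot := by
    rw [← mem_closure_iff_nhdsWithin_neBot, closure_Ioo hab.ne]
    exact hc
  have h1 : ∀ᶠ t in 𝓝[Ioo a b] c, t ∈ Ioo (c - ε / 2) (c + ε / 2) :=
    mem_nhdsWithin_of_mem_nhds (Ioo_mem_nhds (by linarith) (by linarith))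
  -- A local solution started at a time within `ε / 2` of `c` and lasting `ε` covers the `ε /
  -- 2`-neighbourhood of `c`.
  obtain ⟨s, hsU, hs, hsab⟩ := ((hp.eventually hU).and (h1.and self_mem_nhdsWithin)).exists
  obtain ⟨h2, h3⟩ := hα _ hsU
  have h4 : IsMIntegralCurveOn (α (γ s) ∘ (· - s)) v (Ioo (s - ε) (s + ε)) := by
    have := (isMIntegralCurveOn_comp_sub (dt := s)).2 h3
    refine this.mono fun t ht ↦ ?_
    exact ⟨by linarith [ht.1], by linarith [ht.2]⟩
  have h5 := hγ.piecewise_of_locallyLipschitzField hv h4 (t₀ := s)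
    ⟨hsab, by linarith, by linarith⟩ (by simp [h2])
  exact ⟨ε / 2, half_pos hε, _, piecewise_eqOn _ _ _, h5.mono
    (union_subset_union_right _ (Ioo_subset_Ioo (by linarith [hs.2]) (by linarith [hs.1])))⟩

/-- If integral curves have limits at the ends of bounded intervals, they are defined for all
times. -/
theorem LocallyLipschitzField.exists_isMIntegralCurve [CompleteSpace E]
    (hv : LocallyLipschitzField v)
    (hlim : ∀ (γ : ℝ → M) (a b : ℝ), a < b → IsMIntegralCurveOn γ v (Ioo a b) → ∀ c ∈ Icc a b,
      ∃ p, Tendsto γ (𝓝[Ioo a b] c) (𝓝 p)) (x : M) :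
    ∃ γ : ℝ → M, γ 0 = x ∧ IsMIntegralCurve γ v := by
  set S : Set ℝ := {a | ∃ γ : ℝ → M, γ 0 = x ∧ IsMIntegralCurveOn γ v (Ioo (-a) a)} with hS
  obtain ⟨ε, hε, U, hU, α, hα, -⟩ := hv.exists_localFlow x
  have hεS : ε ∈ S := ⟨α x, hα x (mem_of_mem_nhds hU)⟩
  obtain ⟨γ, hγ0, hγ⟩ := hv.exists_isMIntegralCurveOn_iUnion (S := S) (fun a ha ↦ ha) hε hεS
  by_cases hb : BddAbove S
  · exfalso
    set b := sSup S with hbdef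
    have hb0 : 0 < b := hε.trans_le (le_csSup hb hεS)
    have hγb : IsMIntegralCurveOn γ v (Ioo (-b) b) := by
      refine hγ.mono fun t ht ↦ ?_
      obtain ⟨a, ha, hta⟩ := exists_lt_of_lt_csSup ⟨ε, hεS⟩ (abs_lt.2 ht)
      exact mem_iUnion₂.2 ⟨a, ha, abs_lt.1 hta⟩
    obtain ⟨p, hp⟩ := hlim γ _ _ (by linarith) hγb b ⟨by linarith, le_rfl⟩
    obtain ⟨δ, hδ, η, hηγ, hη⟩ := hv.exists_extension (by linarith) ⟨by linarith, le_rfl⟩ hγb hp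
    have hηb : IsMIntegralCurveOn η v (Ioo (-b) (b + δ)) := by
      refine hη.mono fun t ht ↦ ?_
      rcases lt_or_ge t b with h | h
      · exact Or.inl ⟨ht.1, h⟩
      · exact Or.inr ⟨by linarith, ht.2⟩
    -- `S` records symmetric intervals, so the curve must be extended at the left end too before the
    -- supremum is contradicted.
    obtain ⟨q, hq⟩ := hlim η _ _ (by linarith) hηb (-b) ⟨le_rfl, by linarith⟩
    obtain ⟨δ', hδ', θ, hθη, hθ⟩ :=
      hv.exists_extension (by linarith) ⟨le_rfl, by linarith⟩ hηb hq
    have hmem : b + min δ δ' ∈ S := by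
      refine ⟨θ, ?_, hθ.mono fun t ht ↦ ?_⟩
      · rw [hθη ⟨by linarith, by linarith⟩, hηγ ⟨by linarith, by linarith⟩, hγ0]
      · have h1 := min_le_left δ δ'
        have h2 := min_le_right δ δ'
        rcases lt_or_ge (-b) t with h | h
        · exact Or.inl ⟨h, by linarith [ht.2]⟩
        · exact Or.inr ⟨by linarith [ht.1], by linarith⟩
    have := le_csSup hb hmem
    have := lt_min hδ hδ'
    linarith
  · refine ⟨γ, hγ0, isMIntegralCurve_iff_isMIntegralCurveOn.2 (hγ.mono fun t _ ↦ ?_)⟩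
    obtain ⟨a, ha, hta⟩ := not_bddAbove_iff.1 hb |t|
    exact mem_iUnion₂.2 ⟨a, ha, abs_lt.1 hta⟩

/-- A locally Lipschitz vector field whose integral curves are defined for all times has a unique
continuous flow. -/
theorem LocallyLipschitzField.existsUnique_flow [CompleteSpace E]
    (hv : LocallyLipschitzField v)
    (hex : ∀ x : M, ∃ γ : ℝ → M, γ 0 = x ∧ IsMIntegralCurve γ v) :
    ∃! φ : Flow ℝ M, ∀ m, IsMIntegralCurve (fun t ↦ φ t m) v := by
  choose Γ hΓ0 hΓ using hex
  have hadd : ∀ t₁ t₂ x, Γ x (t₁ + t₂) = Γ (Γ x t₂) t₁ := by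
    intro t₁ t₂ x
    have := ((hΓ x).comp_add t₂).eq_of_locallyLipschitzField hv (hΓ (Γ x t₂)) (t₀ := 0)
      (by simp [hΓ0])
    exact congrFun this t₁
  set F : ℝ × M → M := fun z ↦ Γ z.2 z.1 with hF
  have hloc : ∀ p, ∃ ε > 0, ∃ U ∈ 𝓝 p, ContinuousOn F (Ioo (-ε) ε ×ˢ U) := by
    intro p
    obtain ⟨ε, hε, U, hU, α, hα, hαc⟩ := hv.exists_localFlow p
    refine ⟨ε, hε, U, hU, ?_⟩
    have h1 : ContinuousOn (fun z : ℝ × M ↦ α z.2 z.1) (Ioo (-ε) ε ×ˢ U) :=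
      hαc.comp (f := Prod.swap) continuous_swap.continuousOn fun z hz ↦ ⟨hz.2, hz.1⟩
    refine h1.congr fun z hz ↦ ?_
    exact ((hΓ z.2).isMIntegralCurveOn _).eqOn_Ioo_of_locallyLipschitzField hv (t₀ := 0)
      ⟨by linarith, hε⟩ (hα _ hz.2).2 (by rw [hΓ0, (hα _ hz.2).1]) hz.1
  have hcont : Continuous F := by
    rw [continuous_iff_continuousAt]
    rintro ⟨t, x⟩
    set S : Set ℝ := {t | ContinuousAt F (t, x)} with hS
    -- The radius `η` depends on `t₀` alone, not on `s`, so this one property makes `S` both open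
    -- and closed.
    have hprop : ∀ t₀, ∃ η > 0, ∀ s ∈ S, |s - t₀| < η → ∀ r, |r - t₀| < η → r ∈ S := by
      intro t₀
      obtain ⟨ε, hε, U, hU, hc⟩ := hloc (Γ x t₀)
      have h1 : ∀ᶠ s in 𝓝 t₀, U ∈ 𝓝 (Γ x s) :=
        (hΓ x).continuous.continuousAt.eventually (eventually_eventually_nhds.2 hU)
      obtain ⟨η, hη, h2⟩ := Metric.eventually_nhds_iff.1 h1
      refine ⟨min η (ε / 2), lt_min hη (by linarith), fun s hs hst r hr ↦ ?_⟩
      have hsU : U ∈ 𝓝 (Γ x s) := h2 (by rw [Real.dist_eq]; exact hst.trans_le (min_le_left _ _))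
      have hrs : r - s ∈ Ioo (-ε) ε := by
        rw [mem_Ioo, ← abs_lt]
        have h3 := hst.trans_le (min_le_right _ _)
        have h4 := hr.trans_le (min_le_right _ _)
        rw [abs_lt] at *
        constructor <;> linarith
      have h5 : ContinuousAt F (r - s, Γ x s) :=
        hc.continuousAt (prod_mem_nhds (Ioo_mem_nhds hrs.1 hrs.2) hsU)
      have h6 : ContinuousAt (fun z : ℝ × M ↦ (z.1 - s, Γ z.2 s)) (r, x) := by
        refine ContinuousAt.prodMk (by fun_prop) ?_
        exact ContinuousAt.comp (g := F) (f := fun z : ℝ × M ↦ (s, z.2)) (x := (r, x)) hs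
          (by fun_prop)
      -- Group law: flow for time `s`, continuous at `x` as `s ∈ S`, then for the short time `r -
      -- s`, where the local flow is continuous.
      have h7 : F = F ∘ fun z : ℝ × M ↦ (z.1 - s, Γ z.2 s) := by
        funext z
        simp only [hF, Function.comp_apply, ← hadd, sub_add_cancel]
      change ContinuousAt F (r, x)
      rw [h7]
      exact ContinuousAt.comp (g := F) h5 h6
    have hclopen : IsClopen S := by
      refine ⟨isClosed_of_closure_subset fun t₀ ht₀ ↦ ?_, isOpen_iff_mem_nhds.2 fun t₀ ht₀ ↦ ?_⟩
      · obtain ⟨η, hη, h⟩ := hprop t₀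
        obtain ⟨s, hs, hst⟩ := Metric.mem_closure_iff.1 ht₀ η hη
        rw [dist_comm, Real.dist_eq] at hst
        exact h s hs hst t₀ (by simpa using hη)
      · obtain ⟨η, hη, h⟩ := hprop t₀
        filter_upwards [Metric.ball_mem_nhds t₀ hη] with r hr
        exact h t₀ ht₀ (by simpa using hη) r (by simpa [Real.dist_eq] using hr)
    have h0 : (0 : ℝ) ∈ S := by
      obtain ⟨ε, hε, U, hU, hc⟩ := hloc x
      exact hc.continuousAt (prod_mem_nhds (Ioo_mem_nhds (by linarith) hε) hU)
    have : S = univ := hclopen.eq_univ ⟨0, h0⟩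
    exact (this ▸ mem_univ t : t ∈ S)
  refine ⟨⟨fun t x ↦ Γ x t, hcont, hadd, hΓ0⟩, hΓ, fun ψ hψ ↦ ?_⟩
  refine Flow.ext fun t x ↦ ?_
  exact congrFun ((hψ x).eq_of_locallyLipschitzField hv (hΓ x) (t₀ := 0)
    (by rw [hΓ0]; exact ψ.map_zero' x)) t

end Gluing

/-! ### Lengths of integral curves, and completeness -/

section Length

variable {M : Type*} [TopologicalSpace M] [ChartedSpace E M] [IsManifold 𝓘(ℝ, E) 1 M]
  {v : (m : M) → TangentSpace 𝓘(ℝ, E) m} {γ : ℝ → M} {t₀ : ℝ}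

/-- The velocity in a chart is the continuous field evaluated along the curve. This regularity is
needed to compare distance with path length. -/
theorem IsMIntegralCurveAt.contMDiffAt (hv : LocallyLipschitzField v)
    (hγ : IsMIntegralCurveAt γ v t₀) : ContMDiffAt 𝓘(ℝ, ℝ) 𝓘(ℝ, E) 1 γ t₀ := by
  obtain ⟨K, U, hU, hlip⟩ := hv (γ t₀)
  set e := chartAt E (γ t₀) with he
  have hs : γ t₀ ∈ e.source := mem_chart_source E (γ t₀)
  have hder : ∀ᶠ t in 𝓝 t₀, γ t ∈ e.source ∧ HasDerivAt (e ∘ γ) (chartField e v (e (γ t))) t := by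
    filter_upwards [hγ.continuousAt.eventually (e.open_source.mem_nhds hs), hγ] with t h1 h2
    exact ⟨h1, h2.hasDerivAt_chart_comp (chart_mem_atlas E _) h1⟩
  have hU' : ∀ᶠ t in 𝓝 t₀, U ∈ 𝓝 (e (γ t)) :=
    ((e.continuousAt hs).comp hγ.continuousAt).eventually (eventually_eventually_nhds.2 hU)
  refine contMDiffAt_iff_target.2 ⟨hγ.continuousAt, contMDiffAt_iff_contDiffAt.2 ?_⟩
  have hext : (extChartAt 𝓘(ℝ, E) (γ t₀) : M → E) ∘ γ = e ∘ γ := by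
    funext t
    simp [he, extChartAt]
  rw [hext]
  refine contDiffAt_one_iff.2 ⟨fun t ↦
    (1 : ℝ →L[ℝ] ℝ).smulRight (chartField e v (e (γ t))), _, hder.and hU', ?_, ?_⟩
  · rintro t ⟨⟨h1, h2⟩, h3⟩
    have h4 : ContinuousAt (fun t ↦ chartField e v (e (γ t))) t :=
      ContinuousAt.comp (g := chartField e v) (hlip.continuousOn.continuousAt h3) h2.continuousAt
    exact ((ContinuousLinearMap.smulRightL ℝ ℝ E (1 : ℝ →L[ℝ] ℝ)).continuous.continuousAt.comp
      h4).continuousWithinAt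
  · rintro t ⟨⟨h1, h2⟩, h3⟩
    exact h2.hasFDerivAt

end Length

section Complete

variable {M : Type*} [EMetricSpace M] [ChartedSpace E M] [IsManifold 𝓘(ℝ, E) 1 M]
  [RiemannianBundle (fun x : M ↦ TangentSpace 𝓘(ℝ, E) x)] [IsRiemannianManifold 𝓘(ℝ, E) M]
  {v : (m : M) → TangentSpace 𝓘(ℝ, E) m} {γ : ℝ → M}

/-- The distance between two points of an integral curve is at most the increase of a function whose
derivative dominates the speed. -/
theorem LocallyLipschitzField.edist_le_of_norm_le_deriv (hv : LocallyLipschitzField v) {a b : ℝ}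
    (hab : a ≤ b) (hγ : ∀ t ∈ Icc a b, IsMIntegralCurveAt γ v t) {D D' : ℝ → ℝ}
    (hD : ∀ t ∈ Icc a b, HasDerivAt D (D' t) t) (hD' : ∀ t ∈ Icc a b, ‖v (γ t)‖ ≤ D' t) :
    edist (γ a) (γ b) ≤ ENNReal.ofReal (D b - D a) := by
  have hpos : ∀ t ∈ Icc a b, 0 ≤ D' t := fun t ht ↦ (norm_nonneg _).trans (hD' t ht)
  have hcont : ContinuousOn D (Icc a b) := fun t ht ↦ (hD t ht).continuousAt.continuousWithinAt
  -- A nonnegative derivative is automatically integrable, so no continuity of `D'` is required.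
  have hint : MeasureTheory.IntegrableOn D' (Ioc a b) :=
    intervalIntegral.integrableOn_deriv_of_nonneg hcont
      (fun t ht ↦ hD t (Ioo_subset_Icc_self ht)) (fun t ht ↦ hpos t (Ioo_subset_Icc_self ht))
  have hftc : ∫ t in a..b, D' t = D b - D a := by
    refine intervalIntegral.integral_eq_sub_of_hasDerivAt (fun t ht ↦ hD t ?_) ?_
    · rwa [uIcc_of_le hab] at ht
    · exact (intervalIntegrable_iff_integrableOn_Ioc_of_le hab).2 hint
  rw [intervalIntegral.integral_of_le hab] at hftc
  rw [IsRiemannianManifold.out (I := 𝓘(ℝ, E)) (γ a) (γ b)]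
  refine (Manifold.riemannianEDist_le_pathELength
    (fun t ht ↦ ((hγ t ht).contMDiffAt hv).contMDiffWithinAt) rfl rfl hab).trans ?_
  rw [Manifold.pathELength_eq_lintegral_mfderiv_Icc, ← MeasureTheory.restrict_Ioc_eq_restrict_Icc,
    ← hftc, MeasureTheory.ofReal_integral_eq_lintegral_ofReal hint
      ((MeasureTheory.ae_restrict_iff' measurableSet_Ioc).2
        (.of_forall fun t ht ↦ hpos t (Ioc_subset_Icc_self ht)))]
  refine MeasureTheory.setLIntegral_mono' measurableSet_Ioc fun t ht ↦ ?_
  have ht' := Ioc_subset_Icc_self ht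
  have h1 : mfderiv 𝓘(ℝ, ℝ) 𝓘(ℝ, E) γ t (1 : ℝ) = v (γ t) := by
    rw [(hγ t ht').hasMFDerivAt.mfderiv]
    exact one_smul ℝ (v (γ t))
  calc ‖mfderiv 𝓘(ℝ, ℝ) 𝓘(ℝ, E) γ t (1 : ℝ)‖ₑ = ‖v (γ t)‖ₑ := by rw [h1]
    _ = ENNReal.ofReal ‖v (γ t)‖ := (ofReal_norm _).symm
    _ ≤ _ := ENNReal.ofReal_le_ofReal (hD' t ht')

/-- On a complete Riemannian manifold, a bounded locally Lipschitz vector field integrates to a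
unique continuous flow. -/
theorem LocallyLipschitzField.existsUnique_flow_of_bounded [CompleteSpace E] [CompleteSpace M]
    (hv : LocallyLipschitzField v) {C : ℝ} (hC : ∀ m, ‖v m‖ ≤ C) :
    ∃! φ : Flow ℝ M, ∀ m, IsMIntegralCurve (fun t ↦ φ t m) v := by
  refine hv.existsUnique_flow (hv.exists_isMIntegralCurve fun γ a b hab hγ c hc ↦ ?_)
  have hle : ∀ s ∈ Ioo a b, ∀ t ∈ Ioo a b, s ≤ t →
      edist (γ s) (γ t) ≤ ENNReal.ofReal (C * t - C * s) := by
    intro s hs t ht hst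
    refine hv.edist_le_of_norm_le_deriv (D := fun t ↦ C * t) (D' := fun _ ↦ C) hst
      (fun r hr ↦ hγ.isMIntegralCurveAt ?_) (fun r _ ↦ ?_) fun r _ ↦ hC _
    · exact Ioo_mem_nhds (hs.1.trans_le hr.1) (hr.2.trans_lt ht.2)
    · simpa using (hasDerivAt_id r).const_mul C
  have hC0 : 0 ≤ C := (norm_nonneg _).trans (hC (γ a))
  have hlip : LipschitzOnWith C.toNNReal γ (Ioo a b) := by
    have hb : ∀ s ∈ Ioo a b, ∀ t ∈ Ioo a b, s ≤ t →
        edist (γ s) (γ t) ≤ C.toNNReal * edist s t := by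
      intro s hs t ht hst
      refine (hle s hs t ht hst).trans_eq ?_
      rw [edist_comm, edist_dist, Real.dist_eq, abs_of_nonneg (sub_nonneg.2 hst), ← mul_sub,
        ENNReal.ofReal_mul hC0, ENNReal.ofReal]
    intro s hs t ht
    rcases le_total s t with h | h
    · exact hb s hs t ht h
    · rw [edist_comm, edist_comm s]
      exact hb t ht s hs h
  have : (𝓝[Ioo a b] c).NeBot := by
    rw [← mem_closure_iff_nhdsWithin_neBot, closure_Ioo hab.ne]
    exact hc
  exact CompleteSpace.complete ((cauchy_nhds.mono nhdsWithin_le_nhds).map_of_le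
    hlip.uniformContinuousOn inf_le_right)

end Complete

end GlobalFlow

namespace LusternikSchnirelmann

open Set Filter

/-! ### Lipschitz regularity of the normalized gradient -/

section Normalizer

variable {g : ℝ → ℝ}

theorem IsNormalizer.one_le (hg : IsNormalizer g) (x : ℝ) : 1 ≤ g x := by
  rcases le_total x 1 with h | h
  · exact (hg.eq_one x h).ge
  · exact (hg.eq_one 1 le_rfl).ge.trans (hg.mono h)

theorem IsNormalizer.pos (hg : IsNormalizer g) (x : ℝ) : 0 < g x :=
  zero_lt_one.trans_le (hg.one_le x)

/-- Below 2 only `1 ≤ g x` is used, which costs the factor 2. This becomes the bound on the speed of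
the field. -/
theorem IsNormalizer.le_two_mul (hg : IsNormalizer g) (x : ℝ) : x ≤ 2 * g x := by
  rcases le_total x 2 with h | h
  · linarith [hg.one_le x]
  · rw [hg.eq_self x h]
    linarith

/-- The normalizing factor is a `C^1` function of the square of the norm. -/
theorem IsNormalizer.contDiff_inv_comp_sqrt (hg : IsNormalizer g) :
    ContDiff ℝ 1 fun x ↦ 1 / g (Real.sqrt x) := by
  refine contDiff_iff_contDiffAt.2 fun x ↦ ?_
  -- The square root is not smooth at 0, but `g` is constant on the values it takes there.
  rcases lt_or_ge x 1 with h | h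
  · refine (contDiffAt_const (c := (1 : ℝ))).congr_of_eventuallyEq ?_
    filter_upwards [Iio_mem_nhds h] with y hy
    rw [hg.eq_one _ (Real.sqrt_le_one.2 (le_of_lt hy)), div_one]
  · refine contDiffAt_const.div ?_ (hg.pos _).ne'
    exact (hg.smooth.of_le (by exact_mod_cast le_top)).contDiffAt.comp x
      (Real.contDiffAt_sqrt (by linarith))

end Normalizer

section LipschitzRiesz

variable {E : Type*} [NormedAddCommGroup E] [NormedSpace ℝ E]

/-- Representatives of a Lipschitz family of linear forms with respect to a Lipschitz, uniformly
coercive family of bilinear forms form a bounded Lipschitz family. -/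
theorem lipschitzOnWith_of_bilinear_representative {V : Set E} {B : E → E → E → ℝ} {c K : ℝ}
    {L L₀ : NNReal} (hc : 0 < c) (hK : 0 ≤ K)
    (hsub : ∀ y ∈ V, ∀ u u' v, B y (u - u') v = B y u v - B y u' v)
    (hcoer : ∀ y ∈ V, ∀ u, c * ‖u‖ ^ 2 ≤ B y u u)
    (hlip : ∀ y ∈ V, ∀ y' ∈ V, ∀ u v, |B y u v - B y' u v| ≤ K * ‖y - y'‖ * ‖u‖ * ‖v‖)
    {l : E → E →L[ℝ] ℝ} (hl : LipschitzOnWith L l V) (hl₀ : ∀ y ∈ V, ‖l y‖ ≤ L₀)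
    {w : E → E} (hw : ∀ y ∈ V, ∀ v, B y (w y) v = l y v) :
    LipschitzOnWith ((L + K * (L₀ / c)) / c).toNNReal w V := by
  have hcancel : ∀ {x a : ℝ}, 0 ≤ x → 0 ≤ a → c * x ^ 2 ≤ a * x → x ≤ a / c := by
    intro x a hx ha h
    rw [le_div_iff₀ hc]
    rcases hx.eq_or_lt with rfl | hx
    · simpa using ha
    · nlinarith
  have hbound : ∀ y ∈ V, ‖w y‖ ≤ L₀ / c := by
    intro y hy
    refine hcancel (norm_nonneg _) L₀.2 ((hcoer y hy _).trans ?_)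
    rw [hw y hy]
    exact (le_abs_self _).trans (((l y).le_opNorm _).trans (by gcongr; exact hl₀ y hy))
  refine LipschitzOnWith.of_dist_le' fun y hy y' hy' ↦ ?_
  rw [dist_eq_norm, dist_eq_norm, div_mul_eq_mul_div]
  refine hcancel (norm_nonneg _) (by positivity) ((hcoer y hy _).trans ?_)
  set d := w y - w y' with hd
  -- Subtracting the two representation identities separates the variation of the form `l` from that
  -- of the metric `B`.
  have h1 : B y d d = (l y - l y') d - (B y (w y') d - B y' (w y') d) := by
    rw [hd, hsub y hy, hw y hy, hw y' hy', ← hd]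
    simp
  have h2 : |(l y - l y') d| ≤ L * ‖y - y'‖ * ‖d‖ :=
    ((l y - l y').le_opNorm d).trans (by gcongr; exact hl.norm_sub_le hy hy')
  have h3 : |B y (w y') d - B y' (w y') d| ≤ K * ‖y - y'‖ * (L₀ / c) * ‖d‖ :=
    (hlip y hy y' hy' _ _).trans (by gcongr; exact hbound y' hy')
  rw [h1]
  have h4 := abs_le.1 h2
  have h5 := abs_le.1 h3
  calc _ ≤ L * ‖y - y'‖ * ‖d‖ + K * ‖y - y'‖ * (L₀ / c) * ‖d‖ := by linarith [h4.2, h5.1]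
    _ = _ := by ring

end LipschitzRiesz

variable {E : Type*} [NormedAddCommGroup E] [InnerProductSpace ℝ E]

section Differentiability

variable {M : Type*} [TopologicalSpace M] [ChartedSpace E M]
  {e : OpenPartialHomeomorph M E} {f : M → ℝ}

theorem chartField_smul (a : M → ℝ) (v : (m : M) → TangentSpace 𝓘(ℝ, E) m) (y : E) :
    chartField e (fun m ↦ a m • v m) y = a (e.symm y) • chartField e v y :=
  (mfderiv 𝓘(ℝ, E) 𝓘(ℝ, E) e (e.symm y)).map_smul _ _

variable [IsManifold 𝓘(ℝ, E) 1 M]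

theorem IsC11Function.mdifferentiableAt (hf : IsC11Function E f) (m : M) :
    MDifferentiableAt 𝓘(ℝ, E) 𝓘(ℝ, ℝ) f m := by
  set e := chartAt E m with he
  have hm : m ∈ e.source := mem_chart_source E m
  have h1 : MDifferentiableAt 𝓘(ℝ, E) 𝓘(ℝ, ℝ) (f ∘ e.symm) (e m) :=
    (((hf e (chart_mem_atlas E m)).1).differentiableAt
      (e.open_target.mem_nhds (e.map_source hm))).mdifferentiableAt
  have h2 := h1.comp m
    ((mdifferentiable_of_mem_atlas (I := 𝓘(ℝ, E)) (chart_mem_atlas E m)).mdifferentiableAt hm)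
  refine h2.congr_of_eventuallyEq ?_
  filter_upwards [e.open_source.mem_nhds hm] with x hx
  simp [e.left_inv hx]

theorem IsC11Function.mfderiv_apply_mfderiv_symm (hf : IsC11Function E f) (he : e ∈ atlas E M)
    {y : E} (hy : y ∈ e.target) (u : E) :
    (mfderiv 𝓘(ℝ, E) 𝓘(ℝ, ℝ) f (e.symm y) (mfderiv 𝓘(ℝ, E) 𝓘(ℝ, E) e.symm y u) : ℝ) =
      fderiv ℝ (f ∘ e.symm) y u := by
  have h1 := mfderiv_comp_apply y (hf.mdifferentiableAt (e.symm y))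
    ((mdifferentiable_of_mem_atlas (I := 𝓘(ℝ, E)) he).mdifferentiableAt_symm hy) u
  rw [mfderiv_eq_fderiv] at h1
  exact h1.symm

theorem mfderiv_symm_chartField (v : (m : M) → TangentSpace 𝓘(ℝ, E) m) (he : e ∈ atlas E M)
    {y : E} (hy : y ∈ e.target) :
    mfderiv 𝓘(ℝ, E) 𝓘(ℝ, E) e.symm y (chartField (E := E) e v y) = v (e.symm y) := by
  have h := (mdifferentiable_of_mem_atlas (I := 𝓘(ℝ, E)) he).symm_comp_deriv (e.map_target hy)
  rw [e.right_inv hy] at h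
  exact DFunLike.congr_fun h (v (e.symm y))

end Differentiability

section Metric

variable {M : Type*} [TopologicalSpace M] [ChartedSpace E M]
  [RiemannianBundle (fun x : M ↦ TangentSpace 𝓘(ℝ, E) x)]
  {e : OpenPartialHomeomorph M E} {f : M → ℝ} {g : ℝ → ℝ}

theorem chartMetric_sub_left (y u u' w : E) :
    chartMetric e y (u - u') w = chartMetric e y u w - chartMetric e y u' w := by
  unfold chartMetric
  rw [← inner_sub_left]
  congr 1
  exact (mfderiv 𝓘(ℝ, E) 𝓘(ℝ, E) e.symm y).map_sub u u'

theorem IsNormalizer.norm_normalizedField [CompleteSpace E] (hg : IsNormalizer g) (m : M) :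
    ‖(normalizedField g f m : TangentSpace 𝓘(ℝ, E) m)‖ =
      ‖(gradient f m : TangentSpace 𝓘(ℝ, E) m)‖ /
        g ‖(gradient f m : TangentSpace 𝓘(ℝ, E) m)‖ := by
  rw [normalizedField, norm_neg, norm_smul, Real.norm_eq_abs,
    abs_of_pos (one_div_pos.2 (hg.pos _)), one_div_mul_eq_div]

theorem IsNormalizer.norm_normalizedField_le [CompleteSpace E] (hg : IsNormalizer g) (m : M) :
    ‖(normalizedField g f m : TangentSpace 𝓘(ℝ, E) m)‖ ≤ 2 := by
  rw [hg.norm_normalizedField, div_le_iff₀ (hg.pos _)]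
  exact hg.le_two_mul _

variable [IsManifold 𝓘(ℝ, E) 1 M]

/-- The derivative of the chart is bounded for the Riemannian norm and inverts that of `e.symm`, so
`‖u‖` is controlled by the norm of its image. -/
theorem exists_coercive_chartMetric (he : e ∈ atlas E M) {y : E} (hy : y ∈ e.target) :
    ∃ c > 0, ∀ u, c * ‖u‖ ^ 2 ≤ chartMetric e y u u := by
  let B : TangentSpace 𝓘(ℝ, E) (e.symm y) →L[ℝ] E := mfderiv 𝓘(ℝ, E) 𝓘(ℝ, E) e (e.symm y)
  have hB : ∀ u : E, B (mfderiv 𝓘(ℝ, E) 𝓘(ℝ, E) e.symm y u) = u := fun u ↦ DFunLike.congr_fun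
    ((mdifferentiable_of_mem_atlas (I := 𝓘(ℝ, E)) he).comp_symm_deriv hy) u
  refine ⟨1 / (‖B‖ ^ 2 + 1), by positivity, fun u ↦ ?_⟩
  have h1 : ‖u‖ ≤ ‖B‖ * ‖(mfderiv 𝓘(ℝ, E) 𝓘(ℝ, E) e.symm y u :
      TangentSpace 𝓘(ℝ, E) (e.symm y))‖ := by
    conv_lhs => rw [← hB u]
    exact B.le_opNorm _
  have h2 : chartMetric e y u u = ‖(mfderiv 𝓘(ℝ, E) 𝓘(ℝ, E) e.symm y u :
      TangentSpace 𝓘(ℝ, E) (e.symm y))‖ ^ 2 := real_inner_self_eq_norm_sq _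
  rw [h2, one_div_mul_eq_div, div_le_iff₀ (by positivity)]
  have h3 := pow_le_pow_left₀ (norm_nonneg u) h1 2
  rw [mul_pow] at h3
  nlinarith [sq_nonneg ‖(mfderiv 𝓘(ℝ, E) 𝓘(ℝ, E) e.symm y u : TangentSpace 𝓘(ℝ, E) (e.symm y))‖]

/-- Coercivity of the metric in a chart, locally uniform in the point. -/
theorem IsC01Metric.exists_uniform_bounds (hm : IsC01Metric E M) (he : e ∈ atlas E M) {y₀ : E}
    (hy₀ : y₀ ∈ e.target) : ∃ c > 0, ∃ K : ℝ, 0 ≤ K ∧ ∃ V ∈ 𝓝 y₀, V ⊆ e.target ∧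
      (∀ y ∈ V, ∀ u, c * ‖u‖ ^ 2 ≤ chartMetric e y u u) ∧
      ∀ y ∈ V, ∀ y' ∈ V, ∀ u v : E,
        |chartMetric e y u v - chartMetric e y' u v| ≤ K * ‖y - y'‖ * ‖u‖ * ‖v‖ := by
  obtain ⟨c, hc, hcoer⟩ := exists_coercive_chartMetric he hy₀
  obtain ⟨K, U, hU, hUe, hK⟩ := hm e he y₀ hy₀
  have hK' : ∀ y ∈ U, ∀ y' ∈ U, ∀ u v : E,
      |chartMetric e y u v - chartMetric e y' u v| ≤ |K| * ‖y - y'‖ * ‖u‖ * ‖v‖ :=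
    fun y hy y' hy' u v ↦ (hK y hy y' hy' u v).trans (by gcongr; exact le_abs_self K)
  -- On this ball the metric varies by at most half the coercivity constant at `y₀`.
  refine ⟨c / 2, half_pos hc, |K|, abs_nonneg K, U ∩ Metric.ball y₀ (c / 2 / (|K| + 1)),
    inter_mem hU (Metric.ball_mem_nhds _ (by positivity)), inter_subset_left.trans hUe, ?_,
    fun y hy y' hy' ↦ hK' y hy.1 y' hy'.1⟩
  rintro y ⟨hyU, hy⟩ u
  rw [mem_ball_iff_norm, lt_div_iff₀ (by positivity)] at hy
  have h1 := (abs_le.1 (hK' y hyU y₀ (mem_of_mem_nhds hU) u u)).1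
  have h2 := hcoer u
  have h3 : |K| * ‖y - y₀‖ * ‖u‖ * ‖u‖ ≤ c / 2 * ‖u‖ ^ 2 := by
    rw [mul_assoc _ ‖u‖, ← sq]
    gcongr
    nlinarith [norm_nonneg (y - y₀)]
  linarith

variable [CompleteSpace E]

theorem chartMetric_gradient (hf : IsC11Function E f) (he : e ∈ atlas E M) {y : E}
    (hy : y ∈ e.target) (u : E) :
    chartMetric e y (chartField e (gradient f) y) u = fderiv ℝ (f ∘ e.symm) y u := by
  rw [← hf.mfderiv_apply_mfderiv_symm he hy, chartMetric, mfderiv_symm_chartField _ he hy]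
  exact inner_gradient f (e.symm y) _

/-- This expresses the norm through `Df` and the gradient in the chart, both already known to be
locally Lipschitz there. -/
theorem norm_gradient_eq_sqrt (hf : IsC11Function E f) (he : e ∈ atlas E M) {y : E}
    (hy : y ∈ e.target) : ‖(gradient f (e.symm y) : TangentSpace 𝓘(ℝ, E) (e.symm y))‖ =
      Real.sqrt (fderiv ℝ (f ∘ e.symm) y (chartField e (gradient f) y)) := by
  rw [← chartMetric_gradient hf he hy, chartMetric, mfderiv_symm_chartField _ he hy,
    real_inner_self_eq_norm_sq, Real.sqrt_sq (norm_nonneg _)]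

/-- The gradient of a `C^{1,1}` function for a `C^{0,1}` metric is locally Lipschitz in charts. -/
theorem IsC11Function.exists_lipschitzOnWith_chartField_gradient (hf : IsC11Function E f)
    (hm : IsC01Metric E M) (he : e ∈ atlas E M) {y₀ : E} (hy₀ : y₀ ∈ e.target) :
    ∃ V ∈ 𝓝 y₀, V ⊆ e.target ∧ (∃ L, LipschitzOnWith L (fderiv ℝ (f ∘ e.symm)) V) ∧
      ∃ L, LipschitzOnWith L (chartField e (gradient f)) V := by
  obtain ⟨c, hc, K, hK, V, hV, hVe, hcoer, hlip⟩ := hm.exists_uniform_bounds he hy₀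
  obtain ⟨L, U, hU, hL⟩ := (hf e he).2.2 hy₀
  rw [e.open_target.nhdsWithin_eq hy₀] at hU
  set l := fderiv ℝ (f ∘ e.symm) with hl
  have hbd : {y | ‖l y‖ < ‖l y₀‖ + 1} ∈ 𝓝 y₀ :=
    (hL.continuousOn.continuousAt hU).norm.eventually (gt_mem_nhds (lt_add_one _))
  have hLV : LipschitzOnWith L l (V ∩ U ∩ {y | ‖l y‖ < ‖l y₀‖ + 1}) :=
    hL.mono fun y hy ↦ hy.1.2
  refine ⟨_, inter_mem (inter_mem hV hU) hbd, fun y hy ↦ hVe hy.1.1, ⟨L, hLV⟩, _,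
    lipschitzOnWith_of_bilinear_representative (B := chartMetric e) (L₀ := ‖l y₀‖₊ + 1) hc hK
      (fun _ _ ↦ chartMetric_sub_left _) (fun y hy ↦ hcoer y hy.1.1)
      (fun y hy y' hy' ↦ hlip y hy.1.1 y' hy'.1.1) hLV (fun y hy ↦ ?_)
      (fun y hy ↦ chartMetric_gradient hf he (hVe hy.1.1))⟩
  simpa using (le_of_lt hy.2 : ‖l y‖ ≤ ‖l y₀‖ + 1)

theorem IsC11Function.locallyLipschitzField_normalizedField (hf : IsC11Function E f)
    (hm : IsC01Metric E M) (hg : IsNormalizer g) :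
    LocallyLipschitzField (normalizedField (E := E) (M := M) g f) := by
  intro p
  set e := chartAt E p with hep
  have he : e ∈ atlas E M := chart_mem_atlas E p
  have hy₀ : e p ∈ e.target := e.map_source (mem_chart_source E p)
  obtain ⟨V, hV, hVe, ⟨L, hL⟩, L', hL'⟩ := hf.exists_lipschitzOnWith_chartField_gradient hm he hy₀
  set l := fderiv ℝ (f ∘ e.symm) with hl
  set w := chartField e (gradient f) with hw
  -- The field in the chart is this C¹ map applied to the Lipschitz pair `(l, w)`; C¹ maps are
  -- locally Lipschitz.
  let Φ : (E →L[ℝ] ℝ) × E → E := fun z ↦ (-(1 / g (Real.sqrt (z.1 z.2)))) • z.2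
  have hΦ : ContDiff ℝ 1 Φ := by
    refine ContDiff.smul (ContDiff.neg (hg.contDiff_inv_comp_sqrt.comp ?_)) contDiff_snd
    exact contDiff_fst.clm_apply contDiff_snd
  obtain ⟨K, U, hU, hK⟩ := hΦ.contDiffAt.exists_lipschitzOnWith (x := (l (e p), w (e p)))
  have hpair := hL.prodMk hL'
  have hpre : {y | (l y, w y) ∈ U} ∈ 𝓝 (e p) :=
    (hpair.continuousOn.continuousAt hV).preimage_mem_nhds hU
  refine ⟨K * max L L', V ∩ {y | (l y, w y) ∈ U}, inter_mem hV hpre, ?_⟩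
  have hcomp := hK.comp (hpair.mono (inter_subset_left (t := {y | (l y, w y) ∈ U})))
    fun y hy ↦ hy.2
  have heq : EqOn (chartField e (normalizedField (E := E) g f)) (Φ ∘ fun y ↦ (l y, w y))
      (V ∩ {y | (l y, w y) ∈ U}) := by
    intro y hy
    have h1 : normalizedField (E := E) g f = fun m : M ↦
        (-(1 / g ‖(gradient f m : TangentSpace 𝓘(ℝ, E) m)‖)) •
          (gradient f m : TangentSpace 𝓘(ℝ, E) m) := by
      funext m
      rw [normalizedField, neg_smul]
    rw [h1, chartField_smul, norm_gradient_eq_sqrt hf he (hVe hy.1)]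
    rfl
  intro y hy y' hy'
  rw [heq hy, heq hy']
  exact hcomp hy hy'

end Metric

/-- For `x ≤ 1` the denominator is 1; for `x ≥ 1`, `g x ≤ x` makes the quotient at least `x ≥ 1`.
Thus a small decrease rate forces a small gradient. -/
theorem IsNormalizer.sq_le_sq_div {g : ℝ → ℝ} (hg : IsNormalizer g) {ε x : ℝ} (hε : 0 ≤ ε)
    (hε₁ : ε ≤ 1) (hx : ε ≤ x) : ε ^ 2 ≤ x ^ 2 / g x := by
  rw [le_div_iff₀ (hg.pos x)]
  rcases le_total x 1 with h | h
  · rw [hg.eq_one x h, mul_one]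
    gcongr
  · have h1 : g x ≤ x := by
      rcases le_total x 2 with h2 | h2
      · exact hg.le_self x h h2
      · exact (hg.eq_self x h2).le
    calc ε ^ 2 * g x ≤ 1 * x := mul_le_mul (pow_le_one₀ hε hε₁) h1 (hg.pos x).le zero_le_one
      _ ≤ x ^ 2 := by nlinarith

/-! ### Decrease of `f` along the flow, and condition (D) -/

section GradientFlow

variable {E : Type*} [NormedAddCommGroup E] [InnerProductSpace ℝ E] [CompleteSpace E]
  {M : Type*} [EMetricSpace M] [ChartedSpace E M] [IsManifold 𝓘(ℝ, E) 1 M]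
  [RiemannianBundle (fun x : M ↦ TangentSpace 𝓘(ℝ, E) x)]
  {f : M → ℝ} {g : ℝ → ℝ} {φ : Flow ℝ M}

/-- The rate of decrease of `f` along the normalized negative gradient flow. -/
noncomputable def decreaseRate (E : Type*) [NormedAddCommGroup E] [InnerProductSpace ℝ E] [CompleteSpace E]
    {M : Type*} [TopologicalSpace M] [ChartedSpace E M]
    [RiemannianBundle (fun x : M ↦ TangentSpace 𝓘(ℝ, E) x)] (g : ℝ → ℝ) (f : M → ℝ) (m : M) : ℝ :=
  ‖(gradient f m : TangentSpace 𝓘(ℝ, E) m)‖ ^ 2 / g ‖(gradient f m : TangentSpace 𝓘(ℝ, E) m)‖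

omit [IsManifold 𝓘(ℝ, E) 1 M] in
theorem IsNormalizer.decreaseRate_nonneg (hg : IsNormalizer g) (m : M) :
    0 ≤ decreaseRate E g f m :=
  div_nonneg (sq_nonneg _) (hg.pos _).le

omit [IsManifold 𝓘(ℝ, E) 1 M] in
theorem IsNormalizer.decreaseRate_pos (hg : IsNormalizer g) {m : M}
    (hm : (gradient f m : TangentSpace 𝓘(ℝ, E) m) ≠ 0) : 0 < decreaseRate E g f m :=
  div_pos (pow_pos (norm_pos_iff.2 hm) 2) (hg.pos _)

-- The two sides differ by a factor `g ≥ 1` in the denominator. This links distance travelled to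
-- decrease of `f`.
omit [IsManifold 𝓘(ℝ, E) 1 M] in
theorem IsNormalizer.norm_normalizedField_sq_le (hg : IsNormalizer g) (m : M) :
    ‖(normalizedField g f m : TangentSpace 𝓘(ℝ, E) m)‖ ^ 2 ≤ decreaseRate E g f m := by
  rw [hg.norm_normalizedField, decreaseRate, div_pow]
  gcongr
  · exact hg.pos _
  · nlinarith [hg.one_le ‖(gradient f m : TangentSpace 𝓘(ℝ, E) m)‖]

theorem IsFlowOf.hasDerivAt_comp (hφ : IsFlowOf φ (normalizedField (E := E) g f))
    (hf : IsC11Function E f) (m : M) (t : ℝ) :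
    HasDerivAt (fun t ↦ f (φ t m)) (-decreaseRate E g f (φ t m)) t := by
  have h1 := (hf.mdifferentiableAt (φ t m)).hasMFDerivAt.comp t (hφ m t)
  have h2 := (hasMFDerivAt_iff_hasFDerivAt.1 h1)
  refine hasDerivAt_iff_hasFDerivAt.2 (h2.congr_fderiv ?_)
  refine ContinuousLinearMap.ext fun a ↦ ?_
  have h3 : (mfderiv 𝓘(ℝ, E) 𝓘(ℝ, ℝ) f (φ t m) (normalizedField g f (φ t m)) : ℝ) =
      -decreaseRate E g f (φ t m) := by
    rw [← inner_gradient, normalizedField, inner_neg_right, inner_smul_right,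
      real_inner_self_eq_norm_sq, decreaseRate, one_div_mul_eq_div]
  have h4 := (mfderiv 𝓘(ℝ, E) 𝓘(ℝ, ℝ) f (φ t m)).map_smul a (normalizedField g f (φ t m))
  exact h4.trans (congrArg (fun b : ℝ ↦ (show ℝ from a) * b) h3)

theorem IsFlowOf.antitone_comp (hφ : IsFlowOf φ (normalizedField (E := E) g f))
    (hf : IsC11Function E f) (hg : IsNormalizer g) (m : M) : Antitone fun t ↦ f (φ t m) :=
  antitone_of_hasDerivAt_nonpos (hφ.hasDerivAt_comp hf m) fun _ ↦
    neg_nonpos.2 (hg.decreaseRate_nonneg _)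

theorem IsFlowOf.exists_decreaseRate_eq (hφ : IsFlowOf φ (normalizedField (E := E) g f))
    (hf : IsC11Function E f) (m : M) {τ : ℝ} (hτ : 0 < τ) :
    ∃ t ∈ Ioo 0 τ, f m - f (φ τ m) = τ * decreaseRate E g f (φ t m) := by
  obtain ⟨t, ht, h⟩ := exists_hasDerivAt_eq_slope (fun t ↦ f (φ t m)) _ hτ
    (fun t _ ↦ (hφ.hasDerivAt_comp hf m t).continuousAt.continuousWithinAt)
    fun t _ ↦ hφ.hasDerivAt_comp hf m t
  refine ⟨t, ht, ?_⟩
  rw [φ.map_zero_apply, sub_zero, eq_div_iff hτ.ne'] at h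
  linarith

/-- The constant curve at a critical point is an integral curve, so by uniqueness an orbit meeting a
critical point is constant. -/
theorem IsFlowOf.apply_eq_of_gradient_eq_zero (hφ : IsFlowOf φ (normalizedField (E := E) g f))
    (hv : LocallyLipschitzField (normalizedField (E := E) (M := M) g f)) {m : M} {t : ℝ}
    (h : (gradient f (φ t m) : TangentSpace 𝓘(ℝ, E) (φ t m)) = 0) (s : ℝ) : φ s m = m := by
  have h0 : (normalizedField g f (φ t m) : TangentSpace 𝓘(ℝ, E) (φ t m)) = 0 := by
    rw [normalizedField, h, smul_zero, neg_zero]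
  have key : ∀ r, φ r m = φ t m := congrFun ((hφ m).eq_of_locallyLipschitzField hv
    (isMIntegralCurve_const h0) (t₀ := t) rfl)
  rw [key s, ← key 0, φ.map_zero_apply]

variable [IsRiemannianManifold 𝓘(ℝ, E) M]

/-- Points whose value decreases little in time `τ` move little. -/
theorem IsFlowOf.exists_edist_lt (hφ : IsFlowOf φ (normalizedField (E := E) g f))
    (hv : LocallyLipschitzField (normalizedField (E := E) (M := M) g f))
    (hf : IsC11Function E f) (hg : IsNormalizer g) {τ η : ℝ} (hτ : 0 < τ) (hη : 0 < η) :
    ∃ κ > 0, ∀ m, f m - f (φ τ m) < κ → ∀ t ∈ Icc 0 τ,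
      edist m (φ t m) < ENNReal.ofReal η := by
  set δ := η / (2 * τ) with hδ
  have hδ0 : 0 < δ := by positivity
  -- From `x ≤ δ + x² / (4δ)` with `x` the speed, the distance is at most `δ * t` plus the drop over
  -- `4δ`; the choices of `δ` and `κ` bound each by `η / 2`.
  refine ⟨2 * δ * η, by positivity, fun m hm t ht ↦ ?_⟩
  have h1 := hv.edist_le_of_norm_le_deriv (γ := fun t ↦ φ t m)
    (D := fun t ↦ δ * t - f (φ t m) / (4 * δ))
    (D' := fun t ↦ δ - (-decreaseRate E g f (φ t m)) / (4 * δ)) ht.1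
    (fun s _ ↦ (hφ m).isMIntegralCurveAt s) (fun s _ ↦ ?_) fun s _ ↦ ?_
  · simp only [φ.map_zero_apply] at h1
    refine h1.trans_lt ((ENNReal.ofReal_lt_ofReal_iff hη).2 ?_)
    have h2 : f (φ τ m) ≤ f (φ t m) := hφ.antitone_comp hf hg m ht.2
    have h3 : (f m - f (φ t m)) / (4 * δ) < η / 2 := by
      rw [div_lt_iff₀ (by positivity)]
      linarith
    have h4 : δ * t ≤ η / 2 := by
      rw [hδ, div_mul_eq_mul_div, div_le_div_iff₀ (by positivity) two_pos]
      nlinarith [ht.2]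
    rw [sub_div] at h3
    linarith
  · exact ((mul_one δ ▸ (hasDerivAt_id s).const_mul δ).sub
      ((hφ.hasDerivAt_comp hf m s).div_const (4 * δ)))
  · rw [neg_div, sub_neg_eq_add]
    have h2 := hg.norm_normalizedField_sq_le (E := E) (f := f) (φ s m)
    set x := ‖(normalizedField g f (φ s m) : TangentSpace 𝓘(ℝ, E) (φ s m))‖
    have h3 : x - δ ≤ decreaseRate E g f (φ s m) / (4 * δ) := by
      rw [le_div_iff₀ (by positivity)]
      nlinarith [sq_nonneg (x - 2 * δ)]
    linarith

/-- Under the Palais–Smale condition, the normalized negative gradient flow satisfies condition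
(D). -/
theorem IsFlowOf.conditionD (hφ : IsFlowOf φ (normalizedField (E := E) g f))
    (hv : LocallyLipschitzField (normalizedField (E := E) (M := M) g f))
    (hf : IsC11Function E f) (hg : IsNormalizer g) (hPS : PalaisSmale E f) {τ : ℝ} (hτ : 0 < τ) :
    ConditionD f (φ τ) := by
  refine ⟨continuous_iff_continuousAt.2 fun m ↦ (hf.mdifferentiableAt m).continuousAt,
    φ.continuous_toFun τ, fun m hm ↦ ?_, fun A _ ⟨c, hc⟩ hA ↦ ?_⟩
  · obtain ⟨t, -, ht⟩ := hφ.exists_decreaseRate_eq hf m hτ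
    have hpos : 0 < decreaseRate E g f (φ t m) := hg.decreaseRate_pos fun h ↦
      hm (hφ.apply_eq_of_gradient_eq_zero hv h τ)
    nlinarith
  choose y hyA hy using fun n : ℕ ↦ hA (1 / (n + 1)) Nat.one_div_pos_of_nat
  have hdrop : ∀ n : ℕ, f (y n) - f (φ τ (y n)) < 1 / (n + 1) := fun n ↦
    (le_abs_self _).trans_lt (hy n)
  choose t ht hrate using fun n ↦ hφ.exists_decreaseRate_eq hf (y n) hτ
  set z : ℕ → M := fun n ↦ φ (t n) (y n) with hz
  by_cases hcrit : ∃ n, (gradient f (z n) : TangentSpace 𝓘(ℝ, E) (z n)) = 0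
  · obtain ⟨n, hn⟩ := hcrit
    exact ⟨y n, subset_closure (hyA n), hφ.apply_eq_of_gradient_eq_zero hv hn τ⟩
  push Not at hcrit
  have hbdd : ∀ m ∈ range z, |f m| ≤ c + 1 := by
    rintro _ ⟨n, rfl⟩
    have h1 : f (z n) ≤ f (y n) := by
      simpa using hφ.antitone_comp hf hg (y n) (ht n).1.le
    have h2 : f (φ τ (y n)) ≤ f (z n) := hφ.antitone_comp hf hg (y n) (ht n).2.le
    have h3 : (1 : ℝ) / (n + 1) ≤ 1 := by
      rw [div_le_one (by positivity)]
      linarith [n.cast_nonneg (α := ℝ)]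
    have h4 := abs_le.1 (hc (y n) (hyA n))
    rw [abs_le]
    constructor <;> linarith [hdrop n]
  have hsmall : ∀ ε : ℝ, 0 < ε → ∃ m ∈ range z,
      ‖(gradient f m : TangentSpace 𝓘(ℝ, E) m)‖ < ε := by
    intro ε hε
    -- The quadratic lower bound on the decrease rate holds only for thresholds up to 1.
    set ε' := min ε 1 with hε'
    have hε'0 : 0 < ε' := lt_min hε one_pos
    obtain ⟨n, hn⟩ := exists_nat_one_div_lt (show 0 < τ * ε' ^ 2 by positivity)
    refine ⟨z n, mem_range_self n, lt_of_lt_of_le (lt_of_not_ge fun h ↦ ?_) (min_le_left ε 1)⟩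
    have h1 : ε' ^ 2 ≤ decreaseRate E g f (z n) := hg.sq_le_sq_div hε'0.le (min_le_right _ _) h
    have h2 := hdrop n
    rw [hrate n] at h2
    nlinarith
  obtain ⟨p, hp, hp0⟩ := hPS (range z) ⟨c + 1, hbdd⟩ hsmall
  refine ⟨p, EMetric.mem_closure_iff.2 fun η hη ↦ ?_, ?_⟩
  · obtain ⟨η', hη'0, hη'⟩ : ∃ η' : ℝ, 0 < η' ∧ ENNReal.ofReal η' + ENNReal.ofReal η' ≤ η := by
      obtain ⟨r, hr0, hr⟩ := ENNReal.lt_iff_exists_real_btwn.1 hη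
      refine ⟨r / 2, half_pos (ENNReal.ofReal_pos.1 hr.1), ?_⟩
      rw [← ENNReal.ofReal_add (by positivity) (by positivity), add_halves]
      exact hr.2.le
    obtain ⟨κ, hκ, hclose⟩ := hφ.exists_edist_lt hv hf hg hτ hη'0
    obtain ⟨k, hk⟩ := exists_nat_one_div_lt hκ
    -- No `z n` is critical but `p` is, so `p` is not among the finitely many first terms and lies
    -- in the closure of the tail, where the drop is below `κ`.
    have hsplit : range z = z '' Iio k ∪ z '' Ici k := by
      rw [← image_union, Iio_union_Ici, image_univ]
    rw [hsplit, closure_union, ((finite_Iio k).image z).isClosed.closure_eq] at hp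
    rcases hp with ⟨n, -, rfl⟩ | hp
    · exact absurd hp0 (hcrit n)
    obtain ⟨_, ⟨n, hn, rfl⟩, hpn⟩ := EMetric.mem_closure_iff.1 hp _ (ENNReal.ofReal_pos.2 hη'0)
    refine ⟨y n, hyA n, (edist_triangle_right p (y n) (z n)).trans_lt (lt_of_lt_of_le ?_ hη')⟩
    refine ENNReal.add_lt_add hpn (hclose (y n) ((hdrop n).trans (lt_of_le_of_lt ?_ hk)) (t n)
      (Ioo_subset_Icc_self (ht n)))
    exact Nat.one_div_le_one_div hn
  · refine hφ.apply_eq_of_gradient_eq_zero hv (t := 0) ?_ τ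
    rw [φ.map_zero_apply]
    exact hp0

end GradientFlow

end LusternikSchnirelmann

theorem proposition9p1
    {E : Type*} [NormedAddCommGroup E] [InnerProductSpace ℝ E] [CompleteSpace E]
    [TopologicalSpace.SeparableSpace E]
    {M : Type*} [EMetricSpace M] [ChartedSpace E M] [IsManifold 𝓘(ℝ, E) 1 M]
    [RiemannianBundle (fun x : M ↦ TangentSpace 𝓘(ℝ, E) x)]
    [IsContinuousRiemannianBundle E (fun x : M ↦ TangentSpace 𝓘(ℝ, E) x)]
    [IsRiemannianManifold 𝓘(ℝ, E) M] [ConnectedSpace M] [CompleteSpace M]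
    (hM : IsC11Manifold E M) (hmetric : IsC01Metric E M)
    (f : M → ℝ) (hf : IsC11Function E f)
    (g : ℝ → ℝ) (hg : IsNormalizer g) :
    (∃! φ : Flow ℝ M, IsFlowOf φ (normalizedField (E := E) g f)) ∧
    (PalaisSmale E f →
      ∀ φ : Flow ℝ M, IsFlowOf φ (normalizedField (E := E) g f) →
        ∀ τ : ℝ, 0 < τ → ConditionD f (φ τ)) := by
  have hv := hf.locallyLipschitzField_normalizedField hmetric hg
  exact ⟨hv.existsUnique_flow_of_bounded hg.norm_normalizedField_le,
    fun hPS φ hφ τ hτ ↦ hφ.conditionD hv hf hg hPS hτ⟩
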